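/- Let $d\ge 1$ be an integer, $1\le p\le\infty$, $M>0$ and $\beta\in\mathbb R$ with $\beta>d/p$ (where $d/\infty=0$), and put $\mathcal X=[-1,1]^d$. Sobolev ball. Let $r=\lfloor\beta\rfloor$ and $\sigma=\beta-r$, let $\lambda$ be Lebesgue measure on $\mathcal X$, and let $D^\gamma u$ denote weak derivatives on the interior of $\mathcal X$. For $p<\infty$ put $$\|u\|_{W_p^\beta(\mathcal X)}=\Big(\sum_{|\gamma|_1\le r}\|D^\gamma u\|_{L_p(\mathcal X)}^p\Big)^{1/p}\quad\text{if }\sigma=0,$$ $$\|u\|_{W_p^\beta(\mathcal X)}=\Big(\sum_{|\gamma|_1\le r}\|D^\gamma u\|_{L_p(\mathcal X)}^p+\sum_{|\gamma|_1=r}\big(\|D^\gamma u\|_{L_p(\mathcal X)}^p+[D^\gamma u]_{\sigma,p}^p\big)\Big)^{1/p}\quad\text{if }\sigma\in(0,1),$$ where $[w]_{\sigma,p}$ is the $L_p(\mathcal X\times\mathcal X,\lambda\otimes\lambda)$ norm of $(x,y)\mapsto |w(x)-w(y)|\,/\,\|x-y\|_2^{d/p+\sigma}$; for $p=\infty$ the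 $\ell_p$ sums are replaced by maxima. Let $\mathcal F=B_{W_p^\beta(\mathcal X)}(0,M)$ be the set of continuous functions $f:\mathcal X\to\mathbb R$ all of whose weak derivatives of order at most $r$ exist and for which $\|f\|_{W_p^\beta(\mathcal X)}<M$. Minimax regret. Let $\mathcal Y=[-M,M]$ be the label space and let $\hat{\mathcal Y}\subseteq\mathbb R$ be any target space. An admissible forecasting rule is a sequence $\mathcal A=(\mathcal A_t)_{t\ge 1}$ of measurable maps $\mathcal A_t:\hat{\mathcal Y}^{t-1}\times(\mathcal X\times\mathcal Y)^{t-1}\times\mathcal X\to\hat{\mathcal Y}$; on data $(x_t,y_t)_{t\le n}\in(\mathcal X\times\mathcal Y)^n$ it predicts $\hat y_t=\mathcal A_t\big((\hat y_s)_{s<t},(x_s,y_s)_{s<t},x_t\big)$. The minimax regret over $n$ rounds is $$\tilde R_n(\mathcal F)=\inf_{\mathcal A}\ \sup_{(x_t,y_t)_{t\le n}\in(\mathcal X\times\mathcal Y)^n}\ \sup_{f\in\mathcal F}\Big(\sum_{t=1}^n(y_t-\hat y_t)^2-\sum_{t=1}^n(y_t-f(x_t))^2\Big)\in[-\infty,\infty].$$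 Theorem. There are constants $C_1,C_2>0$ depending only on $M,d,\beta,p$ (in particular neither on $n$ nor on $\hat{\mathcal Y}$) such that for every integer $n\ge 1$ $$\tilde R_n(\mathcal F)\ \ge\ \begin{cases} C_1\,n^{1-\beta/d} & \text{if }\beta\le d/2,\\[2pt] C_2\,n^{1-2\beta/(2\beta+d)} & \text{if }\beta>d/2.\end{cases}$$ -/

import Mathlib

open MeasureTheory Set
open scoped ENNReal ContDiff

noncomputable section

/-! ### Sobolev spaces on the cube -/

/-- The cube `[-1,1]^d` in Euclidean space. -/
def cube (d : ℕ) : Set (EuclideanSpace ℝ (Fin d)) :=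
  {x | ∀ i, x i ∈ Icc (-1 : ℝ) 1}

/-- Lebesgue measure on the cube. -/
def cubeMeasure (d : ℕ) : Measure (EuclideanSpace ℝ (Fin d)) :=
  volume.restrict (cube d)

/-- The classical partial derivative `∂f/∂xᵢ`. -/
def partialDeriv {d : ℕ} (i : Fin d) (f : EuclideanSpace ℝ (Fin d) → ℝ) :
    EuclideanSpace ℝ (Fin d) → ℝ :=
  fun x => fderiv ℝ f x (EuclideanSpace.single i 1)

/-- The classical mixed partial derivative `∂₁^{γ₁} ⋯ ∂_d^{γ_d} f`. -/
def multiDeriv {d : ℕ} (γ : Fin d → ℕ) (f : EuclideanSpace ℝ (Fin d) → ℝ) :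
    EuclideanSpace ℝ (Fin d) → ℝ :=
  (List.finRange d).foldr (fun i g => (partialDeriv i)^[γ i] g) f

/-- `v` is the weak derivative `D^γ u` on the (interior of the) cube: both functions are locally
integrable and `∫ u D^γ φ = (-1)^|γ| ∫ v φ` for all `φ ∈ C_c^∞` supported in the open cube. -/
def HasWeakDeriv {d : ℕ} (γ : Fin d → ℕ) (u v : EuclideanSpace ℝ (Fin d) → ℝ) : Prop :=
  LocallyIntegrableOn u (interior (cube d)) ∧
  LocallyIntegrableOn v (interior (cube d)) ∧
  ∀ φ : EuclideanSpace ℝ (Fin d) → ℝ, ContDiff ℝ ∞ φ → HasCompactSupport φ →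
    tsupport φ ⊆ interior (cube d) →
    ∫ x in interior (cube d), u x * multiDeriv γ φ x =
      (-1 : ℝ) ^ (∑ i, γ i) * ∫ x in interior (cube d), v x * φ x

/-- The multi-indices `γ ∈ ℕ^d` with `|γ| = k`. -/
def multiIndices (d k : ℕ) : Finset (Fin d → ℕ) :=
  (Fintype.piFinset fun _ : Fin d => Finset.range (k + 1)).filter fun γ => ∑ i, γ i = k

/-- The multi-indices `γ ∈ ℕ^d` with `|γ| ≤ r`. -/
def multiIndicesLE (d r : ℕ) : Finset (Fin d → ℕ) :=
  (Fintype.piFinset fun _ : Fin d => Finset.range (r + 1)).filter fun γ => ∑ i, γ i ≤ r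

/-- The Gagliardo semi-norm of order `σ`: the `L_p(𝒳 × 𝒳)` norm of
`|w x - w y| / ‖x - y‖₂ ^ (d/p + σ)`, where `d/p = 0` for `p = ∞`
(in which case it is the Hölder semi-norm). -/
def gagliardo {d : ℕ} (p : ℝ≥0∞) (σ : ℝ) (w : EuclideanSpace ℝ (Fin d) → ℝ) : ℝ≥0∞ :=
  eLpNorm
    (fun z : EuclideanSpace ℝ (Fin d) × EuclideanSpace ℝ (Fin d) =>
      |w z.1 - w z.2| / ‖z.1 - z.2‖ ^ ((d : ℝ) * (p⁻¹).toReal + σ))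
    p ((cubeMeasure d).prod (cubeMeasure d))

/-- The `ℓ_p` combination `(a^p + b^p)^{1/p}`, which is `max a b` for `p = ∞`. -/
def lpAdd (p a b : ℝ≥0∞) : ℝ≥0∞ :=
  if p = ⊤ then max a b else (a ^ p.toReal + b ^ p.toReal) ^ (1 / p.toReal)

/-- The `ℓ_p` combination `(∑ a_γ^p)^{1/p}`, which is `max a_γ` for `p = ∞`. -/
def lpSum {ι : Type*} (p : ℝ≥0∞) (s : Finset ι) (a : ι → ℝ≥0∞) : ℝ≥0∞ :=
  if p = ⊤ then s.sup a else (∑ γ ∈ s, a γ ^ p.toReal) ^ (1 / p.toReal)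

/-- The norm of the fractional space of order `σ ∈ (0,1)`. -/
def fracNorm {d : ℕ} (p : ℝ≥0∞) (σ : ℝ) (w : EuclideanSpace ℝ (Fin d) → ℝ) : ℝ≥0∞ :=
  lpAdd p (eLpNorm w p (cubeMeasure d)) (gagliardo p σ w)

/-- The `W_p^β` norm expressed through a family `v` of derivatives, `v γ = D^γ u`.
With `r = ⌊β⌋` it is the `ℓ_p` combination of the `L_p` norms of all `D^γ u`, `|γ| ≤ r`, and, when
`β` is not an integer, of the fractional norms of order `β - r` of all `D^γ u` with `|γ| = r`. -/
def sobolevNormOf {d : ℕ} (p : ℝ≥0∞) (β : ℝ)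
    (v : (Fin d → ℕ) → EuclideanSpace ℝ (Fin d) → ℝ) : ℝ≥0∞ :=
  if β = (⌊β⌋₊ : ℝ) then
    lpSum p (multiIndicesLE d ⌊β⌋₊) fun γ => eLpNorm (v γ) p (cubeMeasure d)
  else
    lpAdd p (lpSum p (multiIndicesLE d ⌊β⌋₊) fun γ => eLpNorm (v γ) p (cubeMeasure d))
      (lpSum p (multiIndices d ⌊β⌋₊) fun γ => fracNorm p (β - ⌊β⌋₊) (v γ))

/-- The `W_p^β([-1,1]^d)` norm of `u`, with value `∞` outside of the space. Weak derivatives are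
unique up to null sets, so all families `v` of weak derivatives give the same value, and the
infimum only serves to return `∞` when some weak derivative does not exist. -/
def sobolevNorm {d : ℕ} (p : ℝ≥0∞) (β : ℝ) (u : EuclideanSpace ℝ (Fin d) → ℝ) : ℝ≥0∞ :=
  ⨅ (v : (Fin d → ℕ) → EuclideanSpace ℝ (Fin d) → ℝ)
    (_ : ∀ γ ∈ multiIndicesLE d ⌊β⌋₊, HasWeakDeriv γ u (v γ)), sobolevNormOf p β v

/-- The open ball of radius `R` centred at `0` in `W_p^β([-1,1]^d)`, as a class of functions on the
cube: the continuous representatives of the elements of the ball. -/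
def sobolevBall (d : ℕ) (p : ℝ≥0∞) (β R : ℝ) : Set (cube d → ℝ) :=
  {g | ∃ f : EuclideanSpace ℝ (Fin d) → ℝ, ContinuousOn f (cube d) ∧
    sobolevNorm p β f < ENNReal.ofReal R ∧ g = (cube d).domRestrict f}

/-! ### Online regression -/

/-- An admissible forecasting rule with inputs in `𝒳`, labels in `Y` and predictions in `Yhat`:
after `t` completed rounds, the next prediction is a measurable function of the `t` past
predictions, the `t` past input-label pairs and the current input. -/
structure Forecaster (𝒳 : Type*) [MeasurableSpace 𝒳] (Y Yhat : Set ℝ) where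
  /-- The prediction map of each round. -/
  rule : (t : ℕ) → (Fin t → Yhat) × (Fin t → 𝒳 × Y) × 𝒳 → Yhat
  measurable_rule : ∀ t, Measurable (rule t)

/-- The predictions that a forecaster makes on a data sequence `(x_t, y_t)_t`. -/
def Forecaster.predict {𝒳 : Type*} [MeasurableSpace 𝒳] {Y Yhat : Set ℝ}
    (A : Forecaster 𝒳 Y Yhat) {n : ℕ} (z : Fin n → 𝒳 × Y) (t : Fin n) : Yhat :=
  A.rule t (fun s : Fin t => A.predict z ⟨s, s.2.trans t.2⟩,
    fun s : Fin t => z ⟨s, s.2.trans t.2⟩, (z t).1)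
termination_by t.val
decreasing_by exact s.2

/-- The regret `R_n(f) = ∑ (y_t - ŷ_t)² - ∑ (y_t - f(x_t))²`. -/
def Forecaster.regret {𝒳 : Type*} [MeasurableSpace 𝒳] {Y Yhat : Set ℝ}
    (A : Forecaster 𝒳 Y Yhat) {n : ℕ} (z : Fin n → 𝒳 × Y) (f : 𝒳 → ℝ) : ℝ :=
  ∑ t, (((z t).2 : ℝ) - (A.predict z t : ℝ)) ^ 2 - ∑ t, (((z t).2 : ℝ) - f (z t).1) ^ 2

/-- The minimax regret over `n` rounds with respect to the benchmark class `F`. -/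
def minimaxRegret {𝒳 : Type*} [MeasurableSpace 𝒳] (Y Yhat : Set ℝ) (F : Set (𝒳 → ℝ)) (n : ℕ) :
    EReal :=
  ⨅ A : Forecaster 𝒳 Y Yhat, ⨆ z : Fin n → 𝒳 × Y, ⨆ f ∈ F, ((A.regret z f : ℝ) : EReal)

end

/-!
The adversary plays on a grid. Put `m = N^d` cells of mesh `1 / N` into the cube, let the inputs run
cyclically through the points of the grid, and let the labels be `± M` with independent uniform
signs. No forecaster beats the prediction `0` on average (`Forecaster.predict_congr` makes each
prediction independent of the current sign). A comparator that takes at each grid point the value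
`a` times the majority sign of the labels seen there gains `2 M a |S_i| - a² n_i` in the cell `i`,
where `S_i` is the sum of the `n_i` signs of that cell, and `E |S_i| ≥ (5/9) √n_i` by Khinchine's
inequality (`sum_abs_signSum_ge`). Hence the regret is at least of order `a √(n m)` as soon as
`a √n` is small against `√m` (`minimaxRegret_ge`).

Such comparators lie in the Sobolev ball when `a` is a small multiple of `N^{-β}`
(`exists_mem_sobolevBall_interpolating`): they are sums of disjoint rescaled bumps `φ(N x - k)`,
whose derivatives of order `r` have size `a N^r` and Lipschitz constant `a N^{r+1}`, up to constants. A
function of size `A` with Lipschitz constant `A N` has Gagliardo semi-norm of order `A N^σ`, by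
rescaling an integrable radial kernel (`exists_gagliardo_le`). The exponent `p` affects only the
constants.

With `N = ⌊n^{1/θ}⌋` and `d ≤ θ ≤ 2 β + d` this gives the rate `n^{1/2 + (d/2 - β)/θ}`
(`exists_minimaxRegret_sobolevBall_ge`). The choice `θ = d`, essentially one round per cell, is best
for `β ≤ d/2`, and `θ = 2 β + d`, the largest admissible value, for `β > d/2`.
-/

/-! ### Random signs -/

/-- The sign `± 1` encoded by a Boolean, with `true` for `+1`. -/
noncomputable def boolSign (b : Bool) : ℝ := if b then 1 else -1

lemma boolSign_not (b : Bool) : boolSign (!b) = -boolSign b := by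
  cases b <;> simp [boolSign]

lemma boolSign_sq (b : Bool) : boolSign b ^ 2 = 1 := by
  cases b <;> simp [boolSign]

lemma abs_boolSign (b : Bool) : |boolSign b| = 1 := by
  cases b <;> simp [boolSign]

/-- Flipping the sign `t` shows that it is uncorrelated with every quantity that ignores it. -/
lemma sum_boolSign_mul_eq_zero {ι : Type*} [Fintype ι] [DecidableEq ι] (t : ι)
    (g : (ι → Bool) → ℝ) (hg : ∀ ε, g (Function.update ε t (!ε t)) = g ε) :
    ∑ ε, boolSign (ε t) * g ε = 0 := by
  have hinv : Function.Involutive fun ε : ι → Bool => Function.update ε t (!ε t) := by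
    intro ε
    ext s
    by_cases h : s = t
    · subst h; simp
    · simp [h]
  have h := Equiv.sum_comp hinv.toPerm fun ε => boolSign (ε t) * g ε
  simp only [Function.Involutive.coe_toPerm, Function.update_self, hg, boolSign_not, neg_mul,
    Finset.sum_neg_distrib] at h
  linarith

/-- The sum of the signs with indices in `J`. -/
noncomputable def signSum {ι : Type*} (J : Finset ι) (ε : ι → Bool) : ℝ :=
  ∑ t ∈ J, boolSign (ε t)

lemma signSum_update {ι : Type*} [DecidableEq ι] {J : Finset ι} {t : ι} (ht : t ∉ J)
    (ε : ι → Bool) (b : Bool) : signSum J (Function.update ε t b) = signSum J ε :=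
  Finset.sum_congr rfl fun s hs => by
    rw [Function.update_of_ne (ne_of_mem_of_not_mem hs ht)]

lemma sum_signSum_sq {ι : Type*} [Fintype ι] [DecidableEq ι] (J : Finset ι) :
    ∑ ε : ι → Bool, signSum J ε ^ 2 = J.card * 2 ^ Fintype.card ι := by
  induction J using Finset.induction_on with
  | empty => simp [signSum]
  | insert t J ht ih =>
    have h0 := sum_boolSign_mul_eq_zero t (fun ε => 2 * signSum J ε)
      (fun ε => by rw [signSum_update ht])
    have : ∀ ε : ι → Bool, signSum (insert t J) ε ^ 2 =
        signSum J ε ^ 2 + boolSign (ε t) * (2 * signSum J ε) + 1 := by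
      intro ε
      rw [signSum, Finset.sum_insert ht, ← signSum]
      linear_combination boolSign_sq (ε t)
    simp_rw [this, Finset.sum_add_distrib, h0, ih, Finset.card_insert_of_notMem ht]
    simp
    ring

lemma sum_signSum_pow_four_le {ι : Type*} [Fintype ι] [DecidableEq ι] (J : Finset ι) :
    ∑ ε : ι → Bool, signSum J ε ^ 4 ≤ 3 * J.card ^ 2 * 2 ^ Fintype.card ι := by
  induction J using Finset.induction_on with
  | empty => simp [signSum]
  | insert t J ht ih =>
    have h0 := sum_boolSign_mul_eq_zero t (fun ε => 4 * signSum J ε ^ 3 + 4 * signSum J ε)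
      (fun ε => by rw [signSum_update ht])
    have : ∀ ε : ι → Bool, signSum (insert t J) ε ^ 4 =
        signSum J ε ^ 4 + boolSign (ε t) * (4 * signSum J ε ^ 3 + 4 * signSum J ε)
          + 6 * signSum J ε ^ 2 + 1 := by
      intro ε
      rw [signSum, Finset.sum_insert ht, ← signSum]
      linear_combination (6 * signSum J ε ^ 2 + 4 * signSum J ε * boolSign (ε t)
        + boolSign (ε t) ^ 2 + 1) * boolSign_sq (ε t)
    simp_rw [this, Finset.sum_add_distrib, h0, ← Finset.mul_sum, sum_signSum_sq,
      Finset.card_insert_of_notMem ht]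
    have h2 : (0 : ℝ) < 2 ^ Fintype.card ι := by positivity
    simp
    nlinarith

/-- Khinchine's inequality for the first absolute moment. It follows from the bounds on the second
and the fourth moments, since `v - v² + (4/27) v⁴ = (4/27) v (v - 3/2)² (v + 3) ≥ 0` for `v ≥ 0`. -/
lemma sum_abs_signSum_ge {ι : Type*} [Fintype ι] [DecidableEq ι] (J : Finset ι) :
    5 / 9 * √J.card * 2 ^ Fintype.card ι ≤ ∑ ε : ι → Bool, |signSum J ε| := by
  rcases J.eq_empty_or_nonempty with rfl | hJ
  · simp [signSum]
  have hs : 0 < √(J.card : ℝ) := Real.sqrt_pos.2 (by exact_mod_cast hJ.card_pos)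
  have hs2 : √(J.card : ℝ) ^ 2 = J.card := Real.sq_sqrt (by positivity)
  set s := √(J.card : ℝ)
  have key : ∀ ε : ι → Bool,
      signSum J ε ^ 2 * s⁻¹ - 4 / 27 * (signSum J ε ^ 4 * (s⁻¹) ^ 3) ≤ |signSum J ε| := by
    intro ε
    have hv : 0 ≤ |signSum J ε| * s⁻¹ := by positivity
    set v := |signSum J ε| * s⁻¹ with hvd
    have h1 : 0 ≤ 4 / 27 * v * (v - 3 / 2) ^ 2 * (v + 3) := by positivity
    have h2 : |signSum J ε| = v * s := by rw [hvd]; field_simp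
    have h4 : signSum J ε ^ 4 = v ^ 4 * s ^ 4 := by
      rw [← mul_pow, ← h2, Even.pow_abs (by decide)]
    have h3 : signSum J ε ^ 2 = v ^ 2 * s ^ 2 := by rw [← mul_pow, ← h2, sq_abs]
    rw [h4, h3, h2]
    have e1 : v ^ 2 * s ^ 2 * s⁻¹ - 4 / 27 * (v ^ 4 * s ^ 4 * s⁻¹ ^ 3)
        = (v ^ 2 - 4 / 27 * v ^ 4) * s := by field_simp
    rw [e1]
    refine mul_le_mul_of_nonneg_right ?_ hs.le
    linarith
  refine le_trans ?_ (Finset.sum_le_sum fun ε _ => key ε)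
  rw [Finset.sum_sub_distrib, ← Finset.sum_mul, ← Finset.mul_sum, ← Finset.sum_mul,
    sum_signSum_sq]
  have h4 := sum_signSum_pow_four_le J
  have h5 := mul_le_mul_of_nonneg_right h4 (by positivity : 0 ≤ s⁻¹ ^ 3)
  have e2 : 3 * (J.card : ℝ) ^ 2 * 2 ^ Fintype.card ι * s⁻¹ ^ 3 = 3 * s * 2 ^ Fintype.card ι := by
    rw [← hs2]; field_simp
  have e3 : (J.card : ℝ) * 2 ^ Fintype.card ι * s⁻¹ = s * 2 ^ Fintype.card ι := by
    rw [← hs2]; field_simp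
  rw [e3]
  rw [e2] at h5
  linarith

/-! ### Random labels against a forecaster -/

/-- Predictions are causal: the prediction of round `t` depends only on the earlier rounds and on
the current input. -/
lemma Forecaster.predict_congr {𝒳 : Type*} [MeasurableSpace 𝒳] {Y Yhat : Set ℝ}
    (A : Forecaster 𝒳 Y Yhat) {n : ℕ} {z z' : Fin n → 𝒳 × Y} (t : Fin n)
    (hlt : ∀ s < t, z s = z' s) (ht : (z t).1 = (z' t).1) : A.predict z t = A.predict z' t := by
  induction t using WellFoundedLT.induction with
  | ind t ih =>
    rw [Forecaster.predict, Forecaster.predict, ht]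
    have h1 : ∀ s : Fin t, A.predict z ⟨s, s.2.trans t.2⟩ = A.predict z' ⟨s, s.2.trans t.2⟩ := by
      intro s
      have hs : (⟨s, s.2.trans t.2⟩ : Fin n) < t := s.2
      exact ih _ hs (fun u hu => hlt u (hu.trans hs)) (by rw [hlt _ hs])
    have h2 : ∀ s : Fin t, z ⟨s, s.2.trans t.2⟩ = z' ⟨s, s.2.trans t.2⟩ := fun s => hlt _ s.2
    simp_rw [h1, h2]

/-- Random labels defeat every forecaster. The inputs run through points `c i`, the labels are
`± M` with independent uniform signs, and the comparator takes at `c i` the value `a` times the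
majority sign of the labels seen there. On average no prediction beats `0`, whereas the comparator
gains `2 M a |S_i| - a² n_i` at `c i`. -/
lemma Forecaster.exists_regret_ge {𝒳 : Type*} [MeasurableSpace 𝒳] {Yhat : Set ℝ} {M : ℝ}
    (hM : 0 ≤ M) (A : Forecaster 𝒳 (Icc (-M) M) Yhat) {ι : Type*} [Fintype ι] [DecidableEq ι]
    (c : ι → 𝒳) {F : Set (𝒳 → ℝ)} {a : ℝ} (ha : 0 ≤ a)
    (hF : ∀ b : ι → Bool, ∃ f ∈ F, ∀ i, f (c i) = a * boolSign (b i))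
    {n : ℕ} (j : Fin n → ι) :
    ∃ z : Fin n → 𝒳 × Icc (-M) M, ∃ f ∈ F,
      10 / 9 * M * a * ∑ i, √((Finset.univ.filter fun t => j t = i).card : ℝ)
      - a ^ 2 * n ≤ A.regret z f := by
  choose f hfF hf using hF
  have hlab : ∀ b : Bool, M * boolSign b ∈ Icc (-M) M := by
    intro b
    cases b <;> simp [boolSign] <;> linarith
  set J : ι → Finset (Fin n) := fun i => Finset.univ.filter fun t => j t = i with hJ
  let z : (Fin n → Bool) → Fin n → 𝒳 × Icc (-M) M := fun ε t => (c (j t), ⟨_, hlab (ε t)⟩)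
  let b : (Fin n → Bool) → ι → Bool := fun ε i => decide (0 ≤ signSum (J i) ε)
  have hb : ∀ ε i, boolSign (b ε i) * signSum (J i) ε = |signSum (J i) ε| := by
    intro ε i
    by_cases h : 0 ≤ signSum (J i) ε
    · simp [b, h, boolSign, abs_of_nonneg h]
    · simp [b, h, boolSign, abs_of_neg (not_le.1 h)]
  set p : (Fin n → Bool) → Fin n → ℝ := fun ε t => (A.predict (z ε) t : ℝ) with hp
  have hreg : ∀ ε, -(2 * M) * ∑ t, boolSign (ε t) * p ε t
      + 2 * M * a * ∑ i, |signSum (J i) ε| - a ^ 2 * n ≤ A.regret (z ε) (f (b ε)) := by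
    intro ε
    have h1 : ∑ i, |signSum (J i) ε| = ∑ t, boolSign (b ε (j t)) * boolSign (ε t) := by
      rw [← Finset.sum_fiberwise (s := Finset.univ) (g := j)]
      refine Finset.sum_congr rfl fun i _ => ?_
      rw [← hb, signSum, Finset.mul_sum]
      refine Finset.sum_congr rfl fun t ht => ?_
      rw [(Finset.mem_filter.1 ht).2]
    have h2 : a ^ 2 * (n : ℝ) = ∑ t : Fin n, a ^ 2 := by simp [mul_comm]
    rw [h1, h2, Forecaster.regret, Finset.mul_sum, Finset.mul_sum, ← Finset.sum_add_distrib,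
      ← Finset.sum_sub_distrib, ← Finset.sum_sub_distrib]
    refine Finset.sum_le_sum fun t _ => ?_
    simp only [z, hf]
    have h3 := boolSign_sq (b ε (j t))
    change _ ≤ (M * boolSign (ε t) - p ε t) ^ 2 - _
    nlinarith [sq_nonneg (p ε t)]
  have hzero : ∑ ε, ∑ t, boolSign (ε t) * p ε t = 0 := by
    rw [Finset.sum_comm]
    refine Finset.sum_eq_zero fun t _ => sum_boolSign_mul_eq_zero t (fun ε => p ε t) fun ε => ?_
    refine congrArg Subtype.val (A.predict_congr t (fun s hs => ?_) rfl)
    simp [z, Function.update_of_ne hs.ne]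
  have hkh : 5 / 9 * (∑ i, √((J i).card : ℝ)) * 2 ^ n ≤ ∑ ε, ∑ i, |signSum (J i) ε| := by
    rw [Finset.sum_comm, Finset.mul_sum, Finset.sum_mul]
    refine Finset.sum_le_sum fun i _ => ?_
    simpa using sum_abs_signSum_ge (J i)
  by_contra! hcon
  have hlt : ∑ ε : Fin n → Bool, A.regret (z ε) (f (b ε)) <
      ∑ ε : Fin n → Bool, (10 / 9 * M * a * ∑ i, √((J i).card : ℝ) - a ^ 2 * n) :=
    Finset.sum_lt_sum_of_nonempty Finset.univ_nonempty fun ε _ => hcon _ _ (hfF _)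
  have hle := Finset.sum_le_sum fun (ε : Fin n → Bool) (_ : ε ∈ Finset.univ) => hreg ε
  rw [Finset.sum_sub_distrib, Finset.sum_add_distrib, ← Finset.mul_sum, ← Finset.mul_sum,
    hzero] at hle
  have hm := mul_le_mul_of_nonneg_left hkh (by positivity : 0 ≤ 2 * M * a)
  simp only [Finset.sum_const, Finset.card_univ, Fintype.card_pi, Fintype.card_bool,
    Finset.prod_const, Fintype.card_fin, nsmul_eq_mul, Nat.cast_pow, Nat.cast_ofNat] at hlt hle
  linarith

/-! ### Derivatives of smooth functions as weak derivatives -/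

lemma ContDiff.partialDeriv {d : ℕ} {f : EuclideanSpace ℝ (Fin d) → ℝ} (hf : ContDiff ℝ ∞ f)
    (i : Fin d) : ContDiff ℝ ∞ (partialDeriv i f) :=
  (hf.fderiv_right (m := ∞) (by simp)).clm_apply contDiff_const

lemma tsupport_partialDeriv_subset {d : ℕ} (f : EuclideanSpace ℝ (Fin d) → ℝ) (i : Fin d) :
    tsupport (partialDeriv i f) ⊆ tsupport f :=
  tsupport_fderiv_apply_subset ℝ _

/-- The composition of the iterated partial derivatives `∂_i^{γ_i}`, `i` running through the
list `l`, the head of the list being applied last. For `l = List.finRange d` it is definitionally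
`multiDeriv γ`. -/
noncomputable def listDeriv {d : ℕ} (γ : Fin d → ℕ) (l : List (Fin d))
    (f : EuclideanSpace ℝ (Fin d) → ℝ) : EuclideanSpace ℝ (Fin d) → ℝ :=
  l.foldr (fun i g => (partialDeriv i)^[γ i] g) f

lemma listDeriv_cons {d : ℕ} (γ : Fin d → ℕ) (i : Fin d) (l : List (Fin d))
    (f : EuclideanSpace ℝ (Fin d) → ℝ) :
    listDeriv γ (i :: l) f = (partialDeriv i)^[γ i] (listDeriv γ l f) := rfl

lemma ContDiff.iterate_partialDeriv {d : ℕ} {f : EuclideanSpace ℝ (Fin d) → ℝ}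
    (hf : ContDiff ℝ ∞ f) (i : Fin d) (k : ℕ) : ContDiff ℝ ∞ ((_root_.partialDeriv i)^[k] f) := by
  induction k generalizing f with
  | zero => exact hf
  | succ k ih => exact ih (hf.partialDeriv i)

lemma tsupport_iterate_partialDeriv_subset {d : ℕ} (f : EuclideanSpace ℝ (Fin d) → ℝ)
    (i : Fin d) (k : ℕ) : tsupport ((partialDeriv i)^[k] f) ⊆ tsupport f := by
  induction k generalizing f with
  | zero => exact subset_rfl
  | succ k ih => exact (ih _).trans (tsupport_partialDeriv_subset f i)

lemma ContDiff.listDeriv {d : ℕ} {f : EuclideanSpace ℝ (Fin d) → ℝ} (hf : ContDiff ℝ ∞ f)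
    (γ : Fin d → ℕ) (l : List (Fin d)) : ContDiff ℝ ∞ (listDeriv γ l f) := by
  induction l with
  | nil => exact hf
  | cons i l ih => exact ih.iterate_partialDeriv i (γ i)

lemma tsupport_listDeriv_subset {d : ℕ} (f : EuclideanSpace ℝ (Fin d) → ℝ)
    (γ : Fin d → ℕ) (l : List (Fin d)) : tsupport (listDeriv γ l f) ⊆ tsupport f := by
  induction l with
  | nil => exact subset_rfl
  | cons i l ih => exact (tsupport_iterate_partialDeriv_subset _ i _).trans ih

lemma integral_mul_partialDeriv {d : ℕ} {f φ : EuclideanSpace ℝ (Fin d) → ℝ}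
    (hf : ContDiff ℝ ∞ f) (hφ : ContDiff ℝ ∞ φ) (hc : HasCompactSupport φ) (i : Fin d) :
    ∫ x, f x * partialDeriv i φ x = -∫ x, partialDeriv i f x * φ x := by
  have hφ' : HasCompactSupport (partialDeriv i φ) :=
    hc.of_isClosed_subset (isClosed_tsupport _) (tsupport_partialDeriv_subset φ i)
  exact integral_mul_fderiv_eq_neg_fderiv_mul_of_integrable
    (((hf.partialDeriv i).continuous.mul hφ.continuous).integrable_of_hasCompactSupport hc.mul_left)
    ((hf.continuous.mul (hφ.partialDeriv i).continuous).integrable_of_hasCompactSupport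
      hφ'.mul_left)
    ((hf.continuous.mul hφ.continuous).integrable_of_hasCompactSupport hc.mul_left)
    (fun x _ => hf.differentiable (by simp) x) (fun x _ => hφ.differentiable (by simp) x)

lemma integral_mul_iterate_partialDeriv {d : ℕ} {f φ : EuclideanSpace ℝ (Fin d) → ℝ}
    (hf : ContDiff ℝ ∞ f) (hφ : ContDiff ℝ ∞ φ) (hc : HasCompactSupport φ) (i : Fin d) (k : ℕ) :
    ∫ x, f x * (partialDeriv i)^[k] φ x = (-1) ^ k * ∫ x, (partialDeriv i)^[k] f x * φ x := by
  induction k generalizing f with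
  | zero => simp
  | succ k ih =>
    have hc' : HasCompactSupport ((partialDeriv i)^[k] φ) :=
      hc.of_isClosed_subset (isClosed_tsupport _) (tsupport_iterate_partialDeriv_subset φ i k)
    rw [Function.iterate_succ_apply', integral_mul_partialDeriv hf (hφ.iterate_partialDeriv i k) hc',
      ih (hf.partialDeriv i), Function.iterate_succ_apply, pow_succ]
    ring

/-- Integration by parts moves the outermost derivative first, hence the reversed list. This makes
the symmetry of mixed partial derivatives unnecessary. -/
lemma integral_mul_listDeriv {d : ℕ} {f φ : EuclideanSpace ℝ (Fin d) → ℝ}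
    (hf : ContDiff ℝ ∞ f) (hφ : ContDiff ℝ ∞ φ) (hc : HasCompactSupport φ) (γ : Fin d → ℕ)
    (l : List (Fin d)) :
    ∫ x, f x * listDeriv γ l φ x =
      (-1) ^ (l.map γ).sum * ∫ x, listDeriv γ l.reverse f x * φ x := by
  induction l generalizing f with
  | nil => simp [listDeriv]
  | cons i l ih =>
    have hc' : HasCompactSupport (listDeriv γ l φ) :=
      hc.of_isClosed_subset (isClosed_tsupport _) (tsupport_listDeriv_subset φ γ l)
    have h : listDeriv γ (i :: l).reverse f =
        listDeriv γ l.reverse ((partialDeriv i)^[γ i] f) := by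
      simp [listDeriv]
    rw [listDeriv_cons, integral_mul_iterate_partialDeriv hf (hφ.listDeriv γ l) hc', h,
      ih (hf.iterate_partialDeriv i _), List.map_cons, List.sum_cons, pow_add]
    ring

/-- The classical derivatives of a smooth function are weak derivatives. The derivatives are taken
in the order in which the integration by parts produces them. -/
lemma ContDiff.hasWeakDeriv {d : ℕ} {f : EuclideanSpace ℝ (Fin d) → ℝ} (hf : ContDiff ℝ ∞ f)
    (γ : Fin d → ℕ) : HasWeakDeriv γ f (_root_.listDeriv γ (List.finRange d).reverse f) := by
  refine ⟨hf.continuous.locallyIntegrable.locallyIntegrableOn _,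
    (hf.listDeriv γ _).continuous.locallyIntegrable.locallyIntegrableOn _, ?_⟩
  intro φ hφ hc hsupp
  have hsum : ((List.finRange d).map γ).sum = ∑ i, γ i := by
    rw [← List.ofFn_eq_map, List.sum_ofFn]
  rw [setIntegral_eq_integral_of_forall_compl_eq_zero, setIntegral_eq_integral_of_forall_compl_eq_zero,
    ← hsum]
  · exact integral_mul_listDeriv hf hφ hc γ (List.finRange d)
  · intro x hx
    rw [image_eq_zero_of_notMem_tsupport fun h => hx (hsupp h), mul_zero]
  · intro x hx
    have h0 : multiDeriv γ φ x = 0 := image_eq_zero_of_notMem_tsupport fun h =>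
      hx (hsupp (tsupport_listDeriv_subset φ γ (List.finRange d) h))
    rw [h0, mul_zero]

/-! ### Superpositions of bumps on a grid -/

/-- The point of `ℤ^d` with coordinates `k`. -/
noncomputable def gridPoint {d N : ℕ} (k : Fin d → Fin N) : EuclideanSpace ℝ (Fin d) :=
  WithLp.toLp 2 fun i => ((k i : ℕ) : ℝ)

lemma one_le_norm_gridPoint_sub {d N : ℕ} {k l : Fin d → Fin N} (h : k ≠ l) :
    1 ≤ ‖gridPoint k - gridPoint l‖ := by
  obtain ⟨i, hi⟩ := Function.ne_iff.1 h
  have h1 : (1 : ℝ) ≤ |((k i : ℕ) : ℝ) - ((l i : ℕ) : ℝ)| := by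
    have : ((k i : ℕ) : ℤ) - (l i : ℕ) ≠ 0 := by
      intro h0
      exact hi (Fin.ext (by omega))
    exact_mod_cast Int.one_le_abs this
  exact h1.trans (PiLp.norm_apply_le (gridPoint k - gridPoint l) i)

/-- The superposition `x ↦ ∑ₖ bₖ ψ(N x - k)` of rescaled copies of `ψ` centred at the points
`k / N`, `k ∈ {0, …, N - 1}^d`. -/
noncomputable def bumpSum {d : ℕ} {F : Type*} [AddCommGroup F] [Module ℝ F] (N : ℕ)
    (b : (Fin d → Fin N) → ℝ) (ψ : EuclideanSpace ℝ (Fin d) → F) (x : EuclideanSpace ℝ (Fin d)) :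
    F :=
  ∑ k, b k • ψ ((N : ℝ) • x - gridPoint k)

lemma bumpSum_center {d N : ℕ} (hN : 0 < N) (b : (Fin d → Fin N) → ℝ)
    {ψ : EuclideanSpace ℝ (Fin d) → ℝ} (hψ : ∀ x, 1 / 2 ≤ ‖x‖ → ψ x = 0) (h0 : ψ 0 = 1)
    (k : Fin d → Fin N) : bumpSum N b ψ ((N : ℝ)⁻¹ • gridPoint k) = b k := by
  have hN' : (N : ℝ) ≠ 0 := by positivity
  rw [bumpSum, Finset.sum_eq_single k]
  · simp [smul_smul, hN', h0]
  · intro l _ hl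
    rw [smul_smul, mul_inv_cancel₀ hN', one_smul, hψ, smul_zero]
    linarith [one_le_norm_gridPoint_sub hl.symm]
  · simp

/-- At most one term of the superposition is nonzero at any given point. -/
lemma norm_bumpSum_le {d : ℕ} {F : Type*} [NormedAddCommGroup F] [NormedSpace ℝ F] {N : ℕ}
    {b : (Fin d → Fin N) → ℝ} {B : ℝ} (hB : 0 ≤ B) (hb : ∀ k, |b k| ≤ B)
    {ψ : EuclideanSpace ℝ (Fin d) → F} (hψ : ∀ x, 1 / 2 ≤ ‖x‖ → ψ x = 0)
    {C : ℝ} (hC : ∀ x, ‖ψ x‖ ≤ C) (x : EuclideanSpace ℝ (Fin d)) : ‖bumpSum N b ψ x‖ ≤ B * C := by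
  have hC0 : 0 ≤ C := (norm_nonneg _).trans (hC 0)
  by_cases h : ∃ k : Fin d → Fin N, ‖(N : ℝ) • x - gridPoint k‖ < 1 / 2
  · obtain ⟨k, hk⟩ := h
    rw [bumpSum, Finset.sum_eq_single k]
    · rw [norm_smul]
      exact mul_le_mul (hb k) (hC _) (norm_nonneg _) hB
    · intro l _ hl
      rw [hψ, smul_zero]
      have h1 := one_le_norm_gridPoint_sub hl
      have h2 := norm_sub_le ((N : ℝ) • x - gridPoint k) ((N : ℝ) • x - gridPoint l)
      rw [sub_sub_sub_cancel_left] at h2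
      linarith
    · simp
  · push Not at h
    rw [bumpSum, Finset.sum_eq_zero fun k _ => by rw [hψ _ (h k), smul_zero], norm_zero]
    positivity

lemma hasFDerivAt_bumpSum {d N : ℕ} (b : (Fin d → Fin N) → ℝ) {ψ : EuclideanSpace ℝ (Fin d) → ℝ}
    (hψ : Differentiable ℝ ψ) (x : EuclideanSpace ℝ (Fin d)) :
    HasFDerivAt (bumpSum N b ψ) (bumpSum N (fun k => N * b k) (fderiv ℝ ψ) x) x := by
  unfold bumpSum
  refine HasFDerivAt.fun_sum fun k _ => ?_
  have h1 : HasFDerivAt (fun y : EuclideanSpace ℝ (Fin d) => (N : ℝ) • y - gridPoint k)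
      ((N : ℝ) • ContinuousLinearMap.id ℝ (EuclideanSpace ℝ (Fin d))) x :=
    ((hasFDerivAt_id x).const_smul (N : ℝ)).sub_const _
  have h2 := ((hψ _).hasFDerivAt.comp x h1).const_smul (b k)
  refine h2.congr_fderiv ?_
  rw [ContinuousLinearMap.comp_smul, ContinuousLinearMap.comp_id, smul_smul, mul_comm]

lemma partialDeriv_bumpSum {d N : ℕ} (b : (Fin d → Fin N) → ℝ)
    {ψ : EuclideanSpace ℝ (Fin d) → ℝ} (hψ : Differentiable ℝ ψ) (i : Fin d) :
    partialDeriv i (bumpSum N b ψ) = bumpSum N (fun k => N * b k) (partialDeriv i ψ) := by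
  ext x
  rw [partialDeriv, (hasFDerivAt_bumpSum b hψ x).fderiv]
  simp [bumpSum, partialDeriv]

lemma iterate_partialDeriv_bumpSum {d N : ℕ} (b : (Fin d → Fin N) → ℝ)
    {ψ : EuclideanSpace ℝ (Fin d) → ℝ} (hψ : ContDiff ℝ ∞ ψ) (i : Fin d) (m : ℕ) :
    (partialDeriv i)^[m] (bumpSum N b ψ) =
      bumpSum N (fun k => (N : ℝ) ^ m * b k) ((partialDeriv i)^[m] ψ) := by
  induction m generalizing b ψ with
  | zero => simp
  | succ m ih =>
    rw [Function.iterate_succ_apply, partialDeriv_bumpSum b (hψ.differentiable (by simp)),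
      ih _ (hψ.partialDeriv i), Function.iterate_succ_apply]
    simp_rw [pow_succ, mul_assoc]

lemma listDeriv_bumpSum {d N : ℕ} (b : (Fin d → Fin N) → ℝ)
    {ψ : EuclideanSpace ℝ (Fin d) → ℝ} (hψ : ContDiff ℝ ∞ ψ) (γ : Fin d → ℕ) (l : List (Fin d)) :
    listDeriv γ l (bumpSum N b ψ) =
      bumpSum N (fun k => (N : ℝ) ^ (l.map γ).sum * b k) (listDeriv γ l ψ) := by
  induction l with
  | nil => simp [listDeriv]
  | cons i l ih =>
    rw [listDeriv_cons, ih, iterate_partialDeriv_bumpSum _ (hψ.listDeriv γ l)]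
    simp [listDeriv_cons, pow_add, mul_assoc]

lemma contDiff_bumpSum {d N : ℕ} (b : (Fin d → Fin N) → ℝ) {ψ : EuclideanSpace ℝ (Fin d) → ℝ}
    (hψ : ContDiff ℝ ∞ ψ) : ContDiff ℝ ∞ (bumpSum N b ψ) :=
  ContDiff.sum fun k _ => ContDiff.const_smul (b k)
    (hψ.comp ((contDiff_id.const_smul (N : ℝ)).sub contDiff_const))

lemma abs_bumpSum_sub_le {d N : ℕ} {b : (Fin d → Fin N) → ℝ} {B : ℝ} (hB : 0 ≤ B)
    (hb : ∀ k, |b k| ≤ B) {ψ : EuclideanSpace ℝ (Fin d) → ℝ} (hψ : Differentiable ℝ ψ)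
    (hs : ∀ x, 1 / 2 ≤ ‖x‖ → fderiv ℝ ψ x = 0) {C : ℝ} (hC : ∀ x, ‖fderiv ℝ ψ x‖ ≤ C)
    (x y : EuclideanSpace ℝ (Fin d)) :
    |bumpSum N b ψ x - bumpSum N b ψ y| ≤ B * C * (N * ‖x - y‖) := by
  have h := convex_univ.norm_image_sub_le_of_norm_hasFDerivWithin_le
    (f := bumpSum N b ψ) (C := N * B * C) (x := y) (y := x)
    (fun z _ => (hasFDerivAt_bumpSum b hψ z).hasFDerivWithinAt)
    (fun z _ => norm_bumpSum_le (by positivity)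
      (fun k => by rw [abs_mul, Nat.abs_cast]; gcongr; exact hb k) hs hC z)
    (mem_univ _) (mem_univ _)
  rw [Real.norm_eq_abs] at h
  linarith

/-- A smooth function supported in a small ball has, together with its first derivative, a uniform
bound that is inherited by all its superpositions. -/
lemma exists_bound_listDeriv {d : ℕ} {φ : EuclideanSpace ℝ (Fin d) → ℝ} (hφ : ContDiff ℝ ∞ φ)
    (hs : tsupport φ ⊆ Metric.closedBall 0 (1 / 4)) (l : List (Fin d)) (γ : Fin d → ℕ) :
    ∃ C : ℝ, 0 ≤ C ∧ ∀ (N : ℕ) (b : (Fin d → Fin N) → ℝ) (B : ℝ), 0 ≤ B → (∀ k, |b k| ≤ B) →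
      (∀ x, |listDeriv γ l (bumpSum N b φ) x| ≤ B * N ^ (l.map γ).sum * C) ∧
      ∀ x y, |listDeriv γ l (bumpSum N b φ) x - listDeriv γ l (bumpSum N b φ) y| ≤
        B * N ^ (l.map γ).sum * C * min 1 (N * ‖x - y‖) := by
  set ψ := listDeriv γ l φ with hψd
  have hψ : ContDiff ℝ ∞ ψ := hφ.listDeriv γ l
  have hψs : tsupport ψ ⊆ Metric.closedBall 0 (1 / 4) := (tsupport_listDeriv_subset φ γ l).trans hs
  have hψc : HasCompactSupport ψ :=
    (isCompact_closedBall _ _).of_isClosed_subset (isClosed_tsupport _) hψs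
  have hfar : ∀ x : EuclideanSpace ℝ (Fin d), 1 / 2 ≤ ‖x‖ → x ∉ Metric.closedBall 0 (1 / 4) := by
    intro x hx hx'
    rw [mem_closedBall_zero_iff] at hx'
    linarith
  obtain ⟨C₀, hC₀⟩ := hψ.continuous.bounded_above_of_compact_support hψc
  obtain ⟨C₁, hC₁⟩ := (hψ.continuous_fderiv (by simp)).bounded_above_of_compact_support
    (hψc.fderiv ℝ)
  have hz : ∀ x, 1 / 2 ≤ ‖x‖ → ψ x = 0 := fun x hx =>
    image_eq_zero_of_notMem_tsupport fun h => hfar x hx (hψs h)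
  have hz' : ∀ x, 1 / 2 ≤ ‖x‖ → fderiv ℝ ψ x = 0 := fun x hx =>
    image_eq_zero_of_notMem_tsupport fun h => hfar x hx (hψs (tsupport_fderiv_subset ℝ h))
  have h0 : 0 ≤ C₀ := (norm_nonneg _).trans (hC₀ 0)
  have h1 : 0 ≤ C₁ := (norm_nonneg _).trans (hC₁ 0)
  refine ⟨2 * C₀ + C₁, by positivity, fun N b B hB hb => ?_⟩
  rw [listDeriv_bumpSum b hφ γ l, ← hψd]
  set P : ℝ := (N : ℝ) ^ (l.map γ).sum
  have hP : 0 ≤ P := by positivity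
  have hBP : 0 ≤ B * P := by positivity
  have hb' : ∀ k, |P * b k| ≤ B * P := fun k => by
    rw [abs_mul, abs_of_nonneg hP, mul_comm]
    exact mul_le_mul_of_nonneg_right (hb k) hP
  have hsup : ∀ x, |bumpSum N (fun k => P * b k) ψ x| ≤ B * P * C₀ := norm_bumpSum_le hBP hb' hz hC₀
  refine ⟨fun x => (hsup x).trans (by gcongr; linarith), fun x y => ?_⟩
  rw [mul_min_of_nonneg _ _ (by positivity), mul_one]
  refine le_min ?_ ?_
  · have h2 := abs_sub (bumpSum N (fun k => P * b k) ψ x) (bumpSum N (fun k => P * b k) ψ y)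
    have h3 : 0 ≤ B * P * C₁ := by positivity
    linarith [hsup x, hsup y]
  · refine (abs_bumpSum_sub_le hBP hb' (hψ.differentiable (by simp)) hz' hC₁ x y).trans ?_
    gcongr
    linarith

/-! ### Sobolev norms of superpositions of bumps -/

lemma isCompact_cube (d : ℕ) : IsCompact (cube d) := by
  have h : cube d = (EuclideanSpace.equiv (Fin d) ℝ).toHomeomorph ⁻¹'
      (Set.pi univ fun _ => Icc (-1 : ℝ) 1) := by
    ext x
    simp [cube, EuclideanSpace.equiv, Pi.le_def, forall_and]
  rw [h, Homeomorph.isCompact_preimage]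
  exact isCompact_univ_pi fun _ => isCompact_Icc

instance isFiniteMeasure_cubeMeasure (d : ℕ) : IsFiniteMeasure (cubeMeasure d) :=
  ⟨by simpa [cubeMeasure] using (isCompact_cube d).measure_lt_top⟩

lemma lpSum_le_sum {ι : Type*} {p : ℝ≥0∞} (hp : 1 ≤ p) (s : Finset ι) (a : ι → ℝ≥0∞) :
    lpSum p s a ≤ ∑ i ∈ s, a i := by
  unfold lpSum
  split_ifs with h
  · exact Finset.sup_le fun i hi => Finset.single_le_sum (fun _ _ => zero_le) hi
  have h1 : 1 ≤ p.toReal := by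
    simpa using ENNReal.toReal_mono h hp
  have h2 : ∑ i ∈ s, a i ^ p.toReal ≤ (∑ i ∈ s, a i) ^ p.toReal := by
    classical
    induction s using Finset.induction_on with
    | empty => simp
    | insert i s hi ih =>
      rw [Finset.sum_insert hi, Finset.sum_insert hi]
      exact (add_le_add le_rfl ih).trans (ENNReal.add_rpow_le_rpow_add _ _ h1)
  rw [one_div, ENNReal.rpow_inv_le_iff (by linarith)]
  exact h2

lemma lpAdd_le_add {p : ℝ≥0∞} (hp : 1 ≤ p) (a b : ℝ≥0∞) : lpAdd p a b ≤ a + b := by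
  unfold lpAdd
  split_ifs with h
  · exact max_le le_self_add le_add_self
  have h1 : 1 ≤ p.toReal := by
    simpa using ENNReal.toReal_mono h hp
  rw [one_div, ENNReal.rpow_inv_le_iff (by linarith)]
  exact ENNReal.add_rpow_le_rpow_add _ _ h1

/-- The kernel that dominates the Gagliardo quotient of a bounded Lipschitz function is
`p`-integrable: near `0` because `σ < 1`, near `∞` because `0 < σ`. -/
lemma lintegral_gagliardo_kernel_lt_top {d : ℕ} (hd : 1 ≤ d) {q σ s : ℝ} (hq : 1 ≤ q)
    (hσ0 : 0 < σ) (hσ1 : σ < 1) (hs : s * q = d + σ * q) :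
    ∫⁻ u : EuclideanSpace ℝ (Fin d), ENNReal.ofReal ((min 1 ‖u‖ / ‖u‖ ^ s) ^ q) < ⊤ := by
  have : Nonempty (Fin d) := ⟨⟨0, hd⟩⟩
  refine Integrable.lintegral_lt_top ?_
  refine (integrable_fun_norm_addHaar (volume : Measure (EuclideanSpace ℝ (Fin d)))
    (f := fun y : ℝ => (min 1 y / y ^ s) ^ q)).2 ?_
  have hcast : ((d - 1 : ℕ) : ℝ) = d - 1 := by push_cast [hd]; ring
  rw [finrank_euclideanSpace_fin, ← Ioc_union_Ioi_eq_Ioi zero_le_one]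
  refine IntegrableOn.union ?_ ?_
  · have h : IntegrableOn (fun y : ℝ => y ^ (-1 + (1 - σ) * q)) (Ioc 0 1) := by
      rw [integrableOn_Ioc_iff_integrableOn_Ioo,
        intervalIntegral.integrableOn_Ioo_rpow_iff zero_lt_one]
      nlinarith
    refine h.congr_fun (fun y hy => ?_) measurableSet_Ioc
    have hy0 : 0 < y := hy.1
    simp only [smul_eq_mul]
    rw [min_eq_right hy.2, Real.div_rpow hy0.le (by positivity), ← Real.rpow_mul hy0.le, hs,
      ← Real.rpow_natCast, hcast, ← Real.rpow_sub hy0, ← Real.rpow_add hy0]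
    congr 1
    ring
  · have h : IntegrableOn (fun y : ℝ => y ^ (-1 - σ * q)) (Ioi 1) :=
      integrableOn_Ioi_rpow_of_lt (by nlinarith) zero_lt_one
    refine h.congr_fun (fun y hy => ?_) measurableSet_Ioi
    have hy1 : 1 < y := hy
    have hy0 : 0 < y := zero_lt_one.trans hy1
    simp only [smul_eq_mul]
    rw [min_eq_left hy1.le, Real.div_rpow zero_le_one (by positivity), ← Real.rpow_mul hy0.le, hs,
      Real.one_rpow, one_div, ← Real.rpow_neg hy0.le, ← Real.rpow_natCast, hcast,
      ← Real.rpow_add hy0]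
    congr 1
    ring

lemma lintegral_comp_natCast_smul {d N : ℕ} (hN : 0 < N) (H : EuclideanSpace ℝ (Fin d) → ℝ≥0∞) :
    ∫⁻ u, H ((N : ℝ) • u) = ENNReal.ofReal (((N : ℝ) ^ d)⁻¹) * ∫⁻ u, H u := by
  have hN' : (N : ℝ) ≠ 0 := by positivity
  have h := lintegral_map_equiv H
    (Homeomorph.smulOfNeZero (α := EuclideanSpace ℝ (Fin d)) (N : ℝ) hN').toMeasurableEquiv
    (μ := volume)
  have hm := Measure.map_addHaar_smul (volume : Measure (EuclideanSpace ℝ (Fin d))) hN'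
  have hm' : Measure.map (Homeomorph.smulOfNeZero (α := EuclideanSpace ℝ (Fin d))
      (N : ℝ) hN').toMeasurableEquiv volume = _ := hm
  rw [hm', lintegral_smul_measure, finrank_euclideanSpace_fin,
    abs_of_nonneg (by positivity)] at h
  simpa using h.symm

/-- A function with values of size `A` and Lipschitz constant `A N` has a Gagliardo semi-norm of
order `A N^σ`. -/
lemma exists_gagliardo_le {d : ℕ} (hd : 1 ≤ d) {p : ℝ≥0∞} (hp : 1 ≤ p) {σ : ℝ}
    (hσ0 : 0 < σ) (hσ1 : σ < 1) :
    ∃ K : ℝ≥0∞, K < ⊤ ∧ ∀ (w : EuclideanSpace ℝ (Fin d) → ℝ) (A : ℝ) (N : ℕ), 0 ≤ A → 0 < N →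
      (∀ x y, |w x - w y| ≤ A * min 1 (N * ‖x - y‖)) →
      gagliardo p σ w ≤ ENNReal.ofReal (A * N ^ σ) * K := by
  -- rescaling by `N` extracts the factor `N ^ s` from the dominating kernel
  have hscale : ∀ (N : ℕ) (s : ℝ) (u : EuclideanSpace ℝ (Fin d)), 0 < N →
      min 1 (N * ‖u‖) / ‖u‖ ^ s = N ^ s * (min 1 ‖(N : ℝ) • u‖ / ‖(N : ℝ) • u‖ ^ s) := by
    intro N s u hN
    have hN0 : (0 : ℝ) < N := by positivity
    have hNs : (0 : ℝ) < (N : ℝ) ^ s := by positivity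
    rw [norm_smul, Real.norm_natCast, Real.mul_rpow hN0.le (norm_nonneg _), mul_div_assoc',
      mul_div_mul_left _ _ hNs.ne']
  by_cases hpt : p = ⊤
  · subst hpt
    refine ⟨1, by simp, fun w A N hA hN hw => ?_⟩
    rw [gagliardo, eLpNorm_exponent_top, mul_one]
    refine eLpNormEssSup_le_of_ae_bound (Filter.Eventually.of_forall fun z => ?_)
    rw [Real.norm_of_nonneg (by positivity)]
    simp only [ENNReal.inv_top, ENNReal.toReal_zero, mul_zero, zero_add]
    refine (div_le_div_of_nonneg_right (hw z.1 z.2) (by positivity)).trans ?_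
    rw [mul_div_assoc, hscale N σ _ hN]
    refine mul_le_mul_of_nonneg_left (mul_le_of_le_one_right (by positivity) ?_) hA
    refine div_le_one_of_le₀ ?_ (by positivity)
    rcases le_total 1 ‖(N : ℝ) • (z.1 - z.2)‖ with h | h
    · exact (min_le_left _ _).trans (Real.one_le_rpow h hσ0.le)
    · refine (min_le_right _ _).trans ?_
      simpa using Real.rpow_le_rpow_of_exponent_ge' (norm_nonneg _) h hσ0.le hσ1.le
  · have hq : 1 ≤ p.toReal := by simpa using ENNReal.toReal_mono hpt hp
    set q := p.toReal with hqd
    have hq0 : 0 < q := by linarith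
    set s : ℝ := (d : ℝ) * (p⁻¹).toReal + σ with hsd
    have hs : s * q = d + σ * q := by
      rw [hsd, ENNReal.toReal_inv, ← hqd]
      field_simp
    set H : EuclideanSpace ℝ (Fin d) → ℝ≥0∞ :=
      fun u => ENNReal.ofReal ((min 1 ‖u‖ / ‖u‖ ^ s) ^ q) with hH
    have hI : ∫⁻ u, H u < ⊤ := lintegral_gagliardo_kernel_lt_top hd hq hσ0 hσ1 hs
    refine ⟨((∫⁻ u, H u) * cubeMeasure d univ) ^ (1 / q),
      ENNReal.rpow_lt_top_of_nonneg (by positivity)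
        (ENNReal.mul_lt_top hI (measure_lt_top _ _)).ne, fun w A N hA hN hw => ?_⟩
    have hN0 : (0 : ℝ) < N := by positivity
    set G : EuclideanSpace ℝ (Fin d) × EuclideanSpace ℝ (Fin d) → ℝ :=
      fun z => A * (min 1 (N * ‖z.1 - z.2‖) / ‖z.1 - z.2‖ ^ s) with hG
    have hmono : gagliardo p σ w ≤ eLpNorm G p ((cubeMeasure d).prod (cubeMeasure d)) := by
      refine eLpNorm_mono_real fun z => ?_
      rw [Real.norm_of_nonneg (by positivity), hG]
      simp only
      rw [← mul_div_assoc]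
      exact div_le_div_of_nonneg_right (hw z.1 z.2) (by positivity)
    have hGH : ∀ x y, ‖G (x, y)‖ₑ ^ q =
        ENNReal.ofReal ((A * N ^ s) ^ q) * H ((N : ℝ) • (x - y)) := by
      intro x y
      have h0 : 0 ≤ G (x, y) := by positivity
      rw [Real.enorm_eq_ofReal h0, ENNReal.ofReal_rpow_of_nonneg h0 hq0.le, hH,
        ← ENNReal.ofReal_mul (by positivity), hG]
      simp only
      rw [hscale N s _ hN, ← mul_assoc, Real.mul_rpow (by positivity) (by positivity)]
    have hmeasH : Measurable H := by fun_prop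
    have hint : ∫⁻ z, ‖G z‖ₑ ^ q ∂((cubeMeasure d).prod (cubeMeasure d)) ≤
        ENNReal.ofReal ((A * N ^ σ) ^ q) * ((∫⁻ u, H u) * cubeMeasure d univ) := by
      calc ∫⁻ z, ‖G z‖ₑ ^ q ∂((cubeMeasure d).prod (cubeMeasure d))
          = ∫⁻ x, ∫⁻ y, ‖G (x, y)‖ₑ ^ q ∂cubeMeasure d ∂cubeMeasure d :=
            lintegral_prod _ (by fun_prop)
        _ ≤ ∫⁻ x, (∫⁻ y, ‖G (x, y)‖ₑ ^ q) ∂cubeMeasure d :=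
            lintegral_mono fun x => setLIntegral_le_lintegral (cube d) _
        _ = ∫⁻ _, ENNReal.ofReal ((A * N ^ σ) ^ q) * (∫⁻ u, H u) ∂cubeMeasure d := by
            refine lintegral_congr fun x => ?_
            simp_rw [hGH]
            rw [lintegral_const_mul _ (by fun_prop),
              lintegral_sub_left_eq_self (fun u => H ((N : ℝ) • u)) x,
              lintegral_comp_natCast_smul hN, ← mul_assoc, ← ENNReal.ofReal_mul (by positivity)]
            congr 2
            rw [Real.mul_rpow hA (by positivity), Real.mul_rpow hA (by positivity),
              ← Real.rpow_mul hN0.le, ← Real.rpow_mul hN0.le, hs, Real.rpow_add hN0,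
              Real.rpow_natCast]
            field_simp
        _ = _ := by rw [lintegral_const, mul_assoc]
    refine hmono.trans ?_
    rw [eLpNorm_eq_lintegral_rpow_enorm_toReal (by positivity) hpt, ← hqd]
    refine (ENNReal.rpow_le_rpow hint (by positivity)).trans ?_
    rw [ENNReal.mul_rpow_of_nonneg _ _ (by positivity), ENNReal.ofReal_rpow_of_nonneg (by positivity)
      (by positivity), ← Real.rpow_mul (by positivity), mul_one_div_cancel hq0.ne', Real.rpow_one]

lemma eLpNorm_cubeMeasure_le {d : ℕ} (p : ℝ≥0∞) {w : EuclideanSpace ℝ (Fin d) → ℝ} {A : ℝ}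
    (hw : ∀ x, |w x| ≤ A) :
    eLpNorm w p (cubeMeasure d) ≤ ENNReal.ofReal A * cubeMeasure d univ ^ p.toReal⁻¹ := by
  rw [mul_comm]
  exact eLpNorm_le_of_ae_bound (Filter.Eventually.of_forall hw)

/-- The Sobolev norm of a superposition of bumps of width `1 / N` and height at most `B` is of
order `B N^β`. -/
lemma exists_sobolevNorm_bumpSum_le {d : ℕ} (hd : 1 ≤ d) {p : ℝ≥0∞} (hp : 1 ≤ p) {β : ℝ}
    (hβ : 0 < β) {φ : EuclideanSpace ℝ (Fin d) → ℝ} (hφ : ContDiff ℝ ∞ φ)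
    (hs : tsupport φ ⊆ Metric.closedBall 0 (1 / 4)) :
    ∃ K : ℝ≥0∞, K < ⊤ ∧ ∀ (N : ℕ) (b : (Fin d → Fin N) → ℝ) (B : ℝ), 0 < N → 0 ≤ B →
      (∀ k, |b k| ≤ B) → sobolevNorm p β (bumpSum N b φ) ≤ ENNReal.ofReal (B * N ^ β) * K := by
  choose C hC0 hC using exists_bound_listDeriv hφ hs (List.finRange d).reverse
  have hsum : ∀ γ : Fin d → ℕ, ((List.finRange d).reverse.map γ).sum = ∑ i, γ i := by
    intro γ
    rw [List.map_reverse, List.sum_reverse, ← List.ofFn_eq_map, List.sum_ofFn]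
  simp only [hsum] at hC
  set r := ⌊β⌋₊ with hr
  have hrβ : (r : ℝ) ≤ β := Nat.floor_le hβ.le
  set V : ℝ≥0∞ := cubeMeasure d univ ^ p.toReal⁻¹ with hV
  have hVtop : V < ⊤ := ENNReal.rpow_lt_top_of_nonneg (by positivity) (measure_ne_top _ _)
  have hLp : ∀ (N : ℕ) (b : (Fin d → Fin N) → ℝ) (B : ℝ), 0 < N → 0 ≤ B → (∀ k, |b k| ≤ B) →
      ∀ γ : Fin d → ℕ, ∑ i, γ i ≤ r →
      eLpNorm (listDeriv γ (List.finRange d).reverse (bumpSum N b φ)) p (cubeMeasure d) ≤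
        ENNReal.ofReal (B * N ^ β) * (ENNReal.ofReal (C γ) * V) := by
    intro N b B hN hB hb γ hγ
    refine (eLpNorm_cubeMeasure_le p (hC γ N b B hB hb).1).trans ?_
    rw [← mul_assoc, ← ENNReal.ofReal_mul (by positivity)]
    gcongr
    · exact hC0 γ
    · rw [← Real.rpow_natCast]
      refine Real.rpow_le_rpow_of_exponent_le (by exact_mod_cast hN) (le_trans ?_ hrβ)
      exact_mod_cast hγ
  have hLE : ∀ γ ∈ multiIndicesLE d r, ∑ i, γ i ≤ r := fun γ hγ => (Finset.mem_filter.1 hγ).2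
  have hEQ : ∀ γ ∈ multiIndices d r, ∑ i, γ i = r := fun γ hγ => (Finset.mem_filter.1 hγ).2
  have hnorm : ∀ (N : ℕ) (b : (Fin d → Fin N) → ℝ), sobolevNorm p β (bumpSum N b φ) ≤
      sobolevNormOf p β fun γ => listDeriv γ (List.finRange d).reverse (bumpSum N b φ) :=
    fun N b => iInf₂_le _ fun γ _ => (contDiff_bumpSum b hφ).hasWeakDeriv γ
  have hfin : ∀ γ, ENNReal.ofReal (C γ) * V < ⊤ := fun γ =>
    ENNReal.mul_lt_top ENNReal.ofReal_lt_top hVtop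
  have hbase : ∀ (N : ℕ) (b : (Fin d → Fin N) → ℝ) (B : ℝ), 0 < N → 0 ≤ B → (∀ k, |b k| ≤ B) →
      (lpSum p (multiIndicesLE d r) fun γ =>
        eLpNorm (listDeriv γ (List.finRange d).reverse (bumpSum N b φ)) p (cubeMeasure d)) ≤
      ENNReal.ofReal (B * N ^ β) * ∑ γ ∈ multiIndicesLE d r, ENNReal.ofReal (C γ) * V := by
    intro N b B hN hB hb
    refine (lpSum_le_sum hp _ _).trans ?_
    rw [Finset.mul_sum]
    exact Finset.sum_le_sum fun γ hγ => hLp N b B hN hB hb γ (hLE γ hγ)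
  by_cases hint : β = (r : ℝ)
  · refine ⟨∑ γ ∈ multiIndicesLE d r, ENNReal.ofReal (C γ) * V,
      ENNReal.sum_lt_top.2 fun γ _ => hfin γ, fun N b B hN hB hb => (hnorm N b).trans ?_⟩
    rw [sobolevNormOf, if_pos hint]
    exact hbase N b B hN hB hb
  · have hσ0 : 0 < β - r := sub_pos.2 (lt_of_le_of_ne hrβ (Ne.symm hint))
    have hσ1 : β - r < 1 := by linarith [Nat.lt_floor_add_one β]
    obtain ⟨K, hK, hgag⟩ := exists_gagliardo_le hd hp hσ0 hσ1
    refine ⟨(∑ γ ∈ multiIndicesLE d r, ENNReal.ofReal (C γ) * V) +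
      ∑ γ ∈ multiIndices d r, (ENNReal.ofReal (C γ) * V + ENNReal.ofReal (C γ) * K),
      ENNReal.add_lt_top.2 ⟨ENNReal.sum_lt_top.2 fun γ _ => hfin γ, ENNReal.sum_lt_top.2 fun γ _ =>
        ENNReal.add_lt_top.2 ⟨hfin γ, ENNReal.mul_lt_top ENNReal.ofReal_lt_top hK⟩⟩,
      fun N b B hN hB hb => (hnorm N b).trans ?_⟩
    have hN0 : (0 : ℝ) < N := by positivity
    rw [sobolevNormOf, if_neg hint, mul_add]
    refine (lpAdd_le_add hp _ _).trans (add_le_add (hbase N b B hN hB hb) ?_)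
    refine (lpSum_le_sum hp _ _).trans ?_
    rw [Finset.mul_sum]
    refine Finset.sum_le_sum fun γ hγ => ?_
    rw [mul_add]
    refine (lpAdd_le_add hp _ _).trans (add_le_add (hLp N b B hN hB hb γ (hEQ γ hγ).le) ?_)
    refine (hgag _ _ N (by have := hC0 γ; positivity) hN (hC γ N b B hB hb).2).trans (le_of_eq ?_)
    rw [← mul_assoc, ← ENNReal.ofReal_mul (by positivity), hEQ γ hγ]
    congr 2
    have : (N : ℝ) ^ β = N ^ r * (N : ℝ) ^ (β - r) := by
      rw [← Real.rpow_natCast, ← Real.rpow_add hN0]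
      congr 1
      ring
    rw [this]
    ring

/-! ### The lower bound -/

lemma gridPoint_mem_cube {d N : ℕ} (hN : 0 < N) (k : Fin d → Fin N) :
    (N : ℝ)⁻¹ • gridPoint k ∈ cube d := by
  intro i
  have hN0 : (0 : ℝ) < N := by positivity
  have h1 : ((k i : ℕ) : ℝ) ≤ N := by exact_mod_cast (k i).2.le
  have h2 : ((N : ℝ)⁻¹ • gridPoint k) i = (k i : ℕ) / (N : ℝ) := by
    simp [gridPoint, div_eq_inv_mul]
  rw [h2]
  exact ⟨by linarith [show (0 : ℝ) ≤ (k i : ℕ) / (N : ℝ) by positivity],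
    div_le_one_of_le₀ h1 hN0.le⟩

/-- The Sobolev ball interpolates every sign pattern of height `c N^{-β}` on the grid of mesh
`1 / N`. -/
lemma exists_mem_sobolevBall_interpolating {d : ℕ} (hd : 1 ≤ d) {p : ℝ≥0∞} (hp : 1 ≤ p) {β M : ℝ}
    (hβ : 0 < β) (hM : 0 < M) :
    ∃ c₀ : ℝ, 0 < c₀ ∧ ∀ c : ℝ, 0 < c → c ≤ c₀ → ∀ (N : ℕ) (hN : 0 < N)
      (b : (Fin d → Fin N) → Bool), ∃ f ∈ sobolevBall d p β M,
        ∀ k, f ⟨(N : ℝ)⁻¹ • gridPoint k, gridPoint_mem_cube hN k⟩ =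
          c * (N : ℝ) ^ (-β) * boolSign (b k) := by
  let φ : ContDiffBump (0 : EuclideanSpace ℝ (Fin d)) :=
    ⟨1 / 8, 1 / 4, by norm_num, by norm_num⟩
  have hφs : tsupport φ ⊆ Metric.closedBall 0 (1 / 4) := φ.tsupport_eq.subset
  have hφ0 : φ 0 = 1 := φ.one_of_mem_closedBall (by simp [φ])
  have hφz : ∀ x, 1 / 2 ≤ ‖x‖ → φ x = 0 := fun x hx =>
    φ.zero_of_le_dist (by rw [dist_zero_right]; simp only [φ]; linarith)
  have hφc : ContDiff ℝ ∞ φ := φ.contDiff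
  obtain ⟨K, hK, hnorm⟩ := exists_sobolevNorm_bumpSum_le hd hp hβ hφc hφs
  refine ⟨M / (2 * (K.toReal + 1)), by positivity, fun c hc hcc N hN b => ?_⟩
  have hN0 : (0 : ℝ) < N := by positivity
  set B : ℝ := c * (N : ℝ) ^ (-β)
  have hB : 0 < B := by positivity
  refine ⟨(cube d).domRestrict (bumpSum N (fun k => B * boolSign (b k)) φ),
    ⟨_, (contDiff_bumpSum _ hφc).continuous.continuousOn, ?_, rfl⟩, fun k => ?_⟩
  · refine (hnorm N _ B hN hB.le fun k => ?_).trans_lt ?_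
    · rw [abs_mul, abs_boolSign, mul_one, abs_of_pos hB]
    have h1 : B * (N : ℝ) ^ β = c := by
      rw [mul_assoc, ← Real.rpow_add hN0]
      simp
    rw [h1, ← ENNReal.ofReal_toReal hK.ne, ← ENNReal.ofReal_mul hc.le,
      ENNReal.ofReal_lt_ofReal_iff hM]
    have hK0 : 0 ≤ K.toReal := ENNReal.toReal_nonneg
    have h2 := mul_le_mul_of_nonneg_right hcc hK0
    refine h2.trans_lt ?_
    rw [div_mul_eq_mul_div, div_lt_iff₀ (by positivity)]
    nlinarith
  · rw [domRestrict_apply]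
    exact bumpSum_center hN _ hφz hφ0 k

/-- Cyclic allocation of `n` rounds to `m` cells gives each cell at least `⌊n / m⌋` rounds. -/
lemma exists_balanced_allocation {ι : Type*} [Fintype ι] [DecidableEq ι] [Nonempty ι] (n : ℕ) :
    ∃ j : Fin n → ι, ∀ i, n / Fintype.card ι ≤ (Finset.univ.filter fun t => j t = i).card := by
  set m := Fintype.card ι with hm
  have hm0 : 0 < m := Fintype.card_pos
  let e : ι ≃ Fin m := Fintype.equivFin ι
  refine ⟨fun t => e.symm ⟨t % m, Nat.mod_lt _ hm0⟩, fun i => ?_⟩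
  have hlt : ∀ s : Fin (n / m), (e i : ℕ) + m * s < n := fun s => by
    have h1 : m * (s + 1) ≤ m * (n / m) := Nat.mul_le_mul_left _ s.2
    have h2 := Nat.mul_div_le n m
    have h3 := (e i).2
    rw [mul_add] at h1
    omega
  rw [← Fintype.card_fin (n / m), ← Finset.card_univ]
  refine Finset.card_le_card_of_injOn (fun s => ⟨(e i : ℕ) + m * s, hlt s⟩) (fun s _ => ?_) ?_
  · have h : ((e i : ℕ) + m * s) % m = e i := by
      rw [Nat.add_mul_mod_self_left, Nat.mod_eq_of_lt (e i).2]
    simp [h]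
  · intro s _ s' _ h
    have h' : (e i : ℕ) + m * s = (e i : ℕ) + m * s' := congrArg Fin.val h
    exact Fin.ext (Nat.eq_of_mul_eq_mul_left hm0 (by omega))

/-- If comparators of height `a` realize all sign patterns on `m ≤ n` points, the minimax regret is
at least of order `a √(n m)`, provided that the gain `a √(n m)` dominates the cost `a² n`. -/
lemma minimaxRegret_ge {𝒳 : Type*} [MeasurableSpace 𝒳] {Yhat : Set ℝ} {M : ℝ} (hM : 0 ≤ M)
    {ι : Type*} [Fintype ι] [DecidableEq ι] [Nonempty ι] (x : ι → 𝒳) {F : Set (𝒳 → ℝ)} {a : ℝ}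
    (ha : 0 ≤ a) (hF : ∀ b : ι → Bool, ∃ f ∈ F, ∀ i, f (x i) = a * boolSign (b i))
    {n : ℕ} (hn : Fintype.card ι ≤ n)
    (han : a * √n ≤ M / 4 * √(Fintype.card ι)) :
    ((M / 2 * a * (√n * √(Fintype.card ι)) : ℝ) : EReal) ≤
      minimaxRegret (Icc (-M) M) Yhat F n := by
  refine le_iInf fun A => ?_
  obtain ⟨j, hj⟩ := exists_balanced_allocation (ι := ι) n
  obtain ⟨z, f, hf, hreg⟩ := A.exists_regret_ge hM x ha hF j
  refine le_trans ?_ (le_iSup_of_le z (le_iSup₂_of_le f hf le_rfl))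
  rw [EReal.coe_le_coe_iff]
  refine le_trans ?_ hreg
  set m := Fintype.card ι with hm
  have hm0 : 0 < m := Fintype.card_pos
  have hm0' : (0 : ℝ) < m := by exact_mod_cast hm0
  have hsm : 0 < √(m : ℝ) := Real.sqrt_pos.2 hm0'
  have hsm2 : √(m : ℝ) * √m = m := Real.mul_self_sqrt hm0'.le
  have hsn2 : √(n : ℝ) * √n = n := Real.mul_self_sqrt (by positivity)
  -- `7 / 10 < 1 / √2` absorbs the rounding loss `⌊n / m⌋ ≥ n / (2 m)`
  have hcell : ∀ i, 7 / 10 * (√(n : ℝ) / √m) ≤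
      √((Finset.univ.filter fun t => j t = i).card : ℝ) := by
    intro i
    refine Real.le_sqrt_of_sq_le ?_
    have h1 : (n : ℝ) ≤ 2 * (m * (n / m : ℕ)) := by
      have h2 : 1 ≤ n / m := (Nat.one_le_div_iff hm0).2 hn
      have h3 := Nat.div_add_mod n m
      have h4 := Nat.mod_lt n hm0
      have h5 : m * 1 ≤ m * (n / m) := Nat.mul_le_mul_left m h2
      exact_mod_cast (by omega : n ≤ 2 * (m * (n / m)))
    have h6 : ((n / m : ℕ) : ℝ) ≤ (Finset.univ.filter fun t => j t = i).card := by
      exact_mod_cast hj i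
    rw [mul_pow, div_pow √(n : ℝ), Real.sq_sqrt (by positivity), Real.sq_sqrt (by positivity)]
    have h7 : (n : ℝ) / m ≤ 2 * (n / m : ℕ) := by
      rw [div_le_iff₀ hm0']
      linarith
    have h8 : (0 : ℝ) ≤ n / m := by positivity
    linarith
  have hsum : 7 / 10 * (√(n : ℝ) * √m) ≤
      ∑ i, √((Finset.univ.filter fun t => j t = i).card : ℝ) := by
    refine le_trans (le_of_eq ?_) (Finset.sum_le_sum fun i _ => hcell i)
    have h : √(n : ℝ) / √m * m = √n * √m := by
      rw [div_mul_eq_mul_div, div_eq_iff hsm.ne', mul_assoc, hsm2]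
    rw [Finset.sum_const, Finset.card_univ, nsmul_eq_mul, ← hm]
    linear_combination (-7 / 10) * h
  have h1 := mul_le_mul_of_nonneg_left hsum (by positivity : 0 ≤ 10 / 9 * M * a)
  have h2 := mul_le_mul_of_nonneg_left han (by positivity : 0 ≤ a * √(n : ℝ))
  have h3 : 0 ≤ M * a * (√(n : ℝ) * √m) := by positivity
  have h4 : a ^ 2 * (n : ℝ) = a * √n * (a * √n) := by
    linear_combination (-(a ^ 2)) * hsn2
  rw [h4]
  -- the gain has the factor `10/9 * 7/10 = 7/9`, the cost at most `1/4`, and `7/9 - 1/4 ≥ 1/2`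
  nlinarith

/-- The rate obtained from a grid of mesh `n^{-1/θ}`. For `θ ≤ 2 β + d` the cost of the
comparators is dominated by their gain. -/
lemma exists_minimaxRegret_sobolevBall_ge {d : ℕ} (hd : 1 ≤ d) {p : ℝ≥0∞} (hp : 1 ≤ p) {β M θ : ℝ}
    (hβ : 0 < β) (hM : 0 < M) (hθ0 : (d : ℝ) ≤ θ) (hθ : θ ≤ 2 * β + d) :
    ∃ C : ℝ, 0 < C ∧ ∀ (Yhat : Set ℝ) (n : ℕ), 1 ≤ n →
      ((C * (n : ℝ) ^ (1 / 2 + (d / 2 - β) / θ) : ℝ) : EReal) ≤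
        minimaxRegret (Icc (-M) M) Yhat (sobolevBall d p β M) n := by
  obtain ⟨c₀, hc₀, hball⟩ := exists_mem_sobolevBall_interpolating hd hp hβ hM
  have hd0 : (0 : ℝ) < d := by exact_mod_cast hd
  have hθpos : 0 < θ := hd0.trans_le hθ0
  set c := min c₀ (M / 4 / 2 ^ (θ / 2)) with hcd
  have hc : 0 < c := lt_min hc₀ (by positivity)
  have hcM : c * 2 ^ (θ / 2) ≤ M / 4 := by
    rw [← le_div_iff₀ (by positivity)]
    exact min_le_right _ _
  refine ⟨M / 2 * c * 2 ^ (-|d / 2 - β|), by positivity, fun Yhat n hn => ?_⟩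
  have hn1 : (1 : ℝ) ≤ n := by exact_mod_cast hn
  have hn0 : (0 : ℝ) < n := by linarith
  set y : ℝ := (n : ℝ) ^ (1 / θ) with hy
  have hy1 : 1 ≤ y := Real.one_le_rpow hn1 (by positivity)
  have hy0 : 0 < y := by linarith
  set N := ⌊y⌋₊ with hNd
  have hN : 0 < N := Nat.floor_pos.2 hy1
  have hN0 : (0 : ℝ) < N := by positivity
  have hN1 : (1 : ℝ) ≤ N := by exact_mod_cast hN
  have hNy : (N : ℝ) ≤ y := Nat.floor_le hy0.le
  have hyN : y ≤ 2 * N := by linarith [Nat.lt_floor_add_one y]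
  have hyθ : y ^ θ = n := by
    rw [hy, ← Real.rpow_mul hn0.le, one_div_mul_cancel hθpos.ne', Real.rpow_one]
  have hcard : Fintype.card (Fin d → Fin N) = N ^ d := by simp
  have : Nonempty (Fin N) := ⟨⟨0, hN⟩⟩
  have hle : Fintype.card (Fin d → Fin N) ≤ n := by
    rw [hcard]
    have : ((N ^ d : ℕ) : ℝ) ≤ n := by
      rw [Nat.cast_pow, ← Real.rpow_natCast, ← hyθ]
      exact (Real.rpow_le_rpow_of_exponent_le hN1 hθ0).trans
        (Real.rpow_le_rpow hN0.le hNy hθpos.le)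
    exact_mod_cast this
  have hsqn : √(n : ℝ) = y ^ (θ / 2) := by
    rw [Real.sqrt_eq_rpow, ← hyθ, ← Real.rpow_mul hy0.le]
    congr 1
    ring
  have hsqm : √(Fintype.card (Fin d → Fin N) : ℝ) = (N : ℝ) ^ ((d : ℝ) / 2) := by
    rw [hcard, Nat.cast_pow, Real.sqrt_eq_rpow, ← Real.rpow_natCast, ← Real.rpow_mul hN0.le]
    congr 1
    ring
  have hsmall : c * (N : ℝ) ^ (-β) * √n ≤ M / 4 * √(Fintype.card (Fin d → Fin N)) := by
    rw [hsqn, hsqm]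
    have h1 : y ^ (θ / 2) ≤ 2 ^ (θ / 2) * (N : ℝ) ^ (θ / 2) := by
      rw [← Real.mul_rpow (by norm_num) hN0.le]
      exact Real.rpow_le_rpow hy0.le hyN (by positivity)
    have h2 : (N : ℝ) ^ (-β) * (N : ℝ) ^ (θ / 2) ≤ (N : ℝ) ^ ((d : ℝ) / 2) := by
      rw [← Real.rpow_add hN0]
      exact Real.rpow_le_rpow_of_exponent_le hN1 (by linarith)
    calc c * (N : ℝ) ^ (-β) * y ^ (θ / 2)
        ≤ c * (N : ℝ) ^ (-β) * (2 ^ (θ / 2) * (N : ℝ) ^ (θ / 2)) := by gcongr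
      _ = c * 2 ^ (θ / 2) * ((N : ℝ) ^ (-β) * (N : ℝ) ^ (θ / 2)) := by ring
      _ ≤ M / 4 * (N : ℝ) ^ ((d : ℝ) / 2) := by gcongr
  refine le_trans (EReal.coe_le_coe_iff.2 ?_) (minimaxRegret_ge hM.le _ (by positivity)
    (hball c hc (min_le_left _ _) N hN) hle hsmall)
  rw [hsqm]
  -- `N` and `y` agree up to a factor of `2`, whatever the sign of the exponent
  have hNpow : 2 ^ (-|d / 2 - β|) * y ^ (d / 2 - β) ≤ (N : ℝ) ^ (d / 2 - β) := by
    rcases le_total 0 ((d : ℝ) / 2 - β) with h | h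
    · rw [abs_of_nonneg h, Real.rpow_neg (by norm_num), inv_mul_le_iff₀ (by positivity),
        ← Real.mul_rpow (by norm_num) hN0.le]
      exact Real.rpow_le_rpow hy0.le hyN h
    · have h1 : y ^ (d / 2 - β) ≤ (N : ℝ) ^ (d / 2 - β) :=
        Real.rpow_le_rpow_of_nonpos hN0 hNy h
      refine (mul_le_of_le_one_left (by positivity) ?_).trans h1
      exact Real.rpow_le_one_of_one_le_of_nonpos (by norm_num) (by simp)
  have hnpow : (n : ℝ) ^ (1 / 2 + (d / 2 - β) / θ) = √n * y ^ (d / 2 - β) := by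
    rw [Real.rpow_add hn0, Real.sqrt_eq_rpow, hy, ← Real.rpow_mul hn0.le]
    congr 2
    ring
  rw [hnpow]
  calc M / 2 * c * 2 ^ (-|d / 2 - β|) * (√n * y ^ (d / 2 - β))
      = M / 2 * c * √n * (2 ^ (-|d / 2 - β|) * y ^ (d / 2 - β)) := by ring
    _ ≤ M / 2 * c * √n * (N : ℝ) ^ (d / 2 - β) := by gcongr
    _ = M / 2 * (c * (N : ℝ) ^ (-β)) * (√n * (N : ℝ) ^ ((d : ℝ) / 2)) := by
      rw [sub_eq_add_neg, Real.rpow_add hN0]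
      ring

theorem theorem4 (d : ℕ) (hd : 1 ≤ d) (p : ℝ≥0∞) (hp : 1 ≤ p) (β : ℝ)
    (hβ : (d : ℝ≥0∞) / p < ENNReal.ofReal β) (M : ℝ) (hM : 0 < M) :
    (β ≤ (d : ℝ) / 2 →
      ∃ C₁ : ℝ, 0 < C₁ ∧ ∀ (Yhat : Set ℝ) (n : ℕ), 1 ≤ n →
        ((C₁ * (n : ℝ) ^ (1 - β / d) : ℝ) : EReal) ≤
          minimaxRegret (Icc (-M) M) Yhat (sobolevBall d p β M) n) ∧
    ((d : ℝ) / 2 < β →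
      ∃ C₂ : ℝ, 0 < C₂ ∧ ∀ (Yhat : Set ℝ) (n : ℕ), 1 ≤ n →
        ((C₂ * (n : ℝ) ^ (1 - 2 * β / (2 * β + d)) : ℝ) : EReal) ≤
          minimaxRegret (Icc (-M) M) Yhat (sobolevBall d p β M) n) := by
  have hβ0 : 0 < β := ENNReal.ofReal_pos.1 (zero_le.trans_lt hβ)
  have hd0 : (0 : ℝ) < d := by exact_mod_cast hd
  constructor
  · intro _
    have h := exists_minimaxRegret_sobolevBall_ge hd hp hβ0 hM le_rfl
      (by linarith : (d : ℝ) ≤ 2 * β + d)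
    have he : 1 / 2 + ((d : ℝ) / 2 - β) / d = 1 - β / d := by field_simp; ring
    rwa [he] at h
  · intro _
    have h := exists_minimaxRegret_sobolevBall_ge hd hp hβ0 hM
      (by linarith : (d : ℝ) ≤ 2 * β + d) le_rfl
    have he : 1 / 2 + ((d : ℝ) / 2 - β) / (2 * β + d) = 1 - 2 * β / (2 * β + d) := by
      field_simp
      ring
    rwa [he] at h
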